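/- A \emph{plane tree} is a finite rooted tree in which the children of every vertex are ordered from left to right. View a plane tree as (the Hasse diagram of) a poset whose maximal element is the root. For plane trees $S$ and $T$, an \emph{embedding} of $S$ into $T$ is a set $A$ of vertices of $T$ such that there is an order isomorphism from $S$ onto $A$ (with the order induced from $T$) under which the left-to-right order of the children of each vertex of $S$ is the one inherited from $T$. The embedding is \emph{good} if $A$ contains the root of $T$. Write $S\subseteq T$ if at least one embedding of $S$ into $T$ exists. Let $a_T(S)$ be the number of all embeddings of $S$ into $T$ and $g_T(S)$ the number of good ones. Let $\mathcal{B}_n$ be the set of plane binary trees with $n$ vertices, i.e. plane trees in which every vertex has either $0$ or $2$ children (so $\mathcal{B}_n=\emptyset$ for even $n$), and put $a_{\mathcal{B}_n}(S)=\sum_{T\in\mathcal{B}_n}a_T(S)$ and $g_{\mathcal{B}_n}(S)=\sum_{T\in\mathcal{B}_n}g_T(S)$. \textbf{Theorem.} Let $S_1,S_2$ be plane trees with $S_1\subseteq S_2$. Then for all sufficiently large odd $n$ the numbers $a_{\mathcal{B}_n}(S_1)$ and $a_{\mathcal{B}_n}(S_2)$ are positive and $$\frac{g_{\mathcal{B}_n}(S_1)}{a_{\mathcal{B}_n}(S_1)}\le\frac{g_{\mathcal{B}_n}(S_2)}{a_{\mathcal{B}_n}(S_2)}.$$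 -/

import Mathlib

/-- Finite rooted plane trees: a root together with the left-to-right list of its subtrees. -/
inductive PlaneTree : Type where
  | node (children : List PlaneTree) : PlaneTree

namespace PlaneTree

/- A vertex of a plane tree is named by the path that leads to it from the root: the root is `[]`,
and `i :: p` is the vertex `p` of the `i`-th subtree (counted from `0`, from left to right). -/
mutual
/-- The finite set of vertices of a plane tree. -/
def vertices : PlaneTree → Finset (List ℕ)
  | node ts => insert [] (forestVertices 0 ts)
/-- The vertices of the trees in a list, the first tree of which has position `i` below the root. -/
def forestVertices : ℕ → List PlaneTree → Finset (List ℕ)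
  | _, [] => ∅
  | i, t :: ts => (vertices t).image (List.cons i) ∪ forestVertices (i + 1) ts
end

/-- The size of a tree is its number of vertices. -/
def size (T : PlaneTree) : ℕ := T.vertices.card

/-- `LeftOf p q`: the vertices `p` and `q` are incomparable in the tree order and `p` lies to the
left of `q`, that is, where the paths to them part for the first time, the one to `p` turns
further to the left. -/
def LeftOf (p q : List ℕ) : Prop :=
  ∃ (c p' q' : List ℕ) (i j : ℕ), p = c ++ i :: p' ∧ q = c ++ j :: q' ∧ i < j

/-- `IsEmbedding S T A`: the set `A` of vertices of `T` is a plane embedding of `S` into `T`. Here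
`T` is the Hasse diagram of a poset with the root as the maximal element, so that `v` lies weakly
below `u` exactly if the path to `u` is a prefix of the path to `v`. The set `A` with the induced
order has to be isomorphic to the poset `S`, in such a way that the left-to-right order of the
children of each vertex of `S` is the one inherited from `T`. -/
def IsEmbedding (S T : PlaneTree) (A : Finset (List ℕ)) : Prop :=
  A ⊆ T.vertices ∧
    ∃ f : List ℕ → List ℕ,
      Set.BijOn f (S.vertices : Set (List ℕ)) (A : Set (List ℕ)) ∧
      (∀ u ∈ S.vertices, ∀ v ∈ S.vertices, (u <+: v ↔ f u <+: f v)) ∧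
      (∀ (u : List ℕ) (i j : ℕ), u ++ [i] ∈ S.vertices → u ++ [j] ∈ S.vertices → i < j →
        LeftOf (f (u ++ [i])) (f (u ++ [j])))

/-- `S ⊆ T`: there is at least one plane embedding of `S` into `T`. -/
instance : HasSubset PlaneTree where
  Subset S T := ∃ A : Finset (List ℕ), IsEmbedding S T A

open Classical in
/-- The number `a_T(S)` of all embeddings of `S` into `T`. -/
noncomputable def allCount (T S : PlaneTree) : ℕ :=
  (T.vertices.powerset.filter fun A => IsEmbedding S T A).card

open Classical in
/-- The number `g_T(S)` of good embeddings of `S` into `T`: those that contain the root of `T`. -/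
noncomputable def goodCount (T S : PlaneTree) : ℕ :=
  (T.vertices.powerset.filter fun A => IsEmbedding S T A ∧ [] ∈ A).card

/-- Plane binary trees: every vertex has either no child or exactly two children. -/
inductive IsBinary : PlaneTree → Prop
  | leaf : IsBinary (node [])
  | node₂ (l r : PlaneTree) : IsBinary l → IsBinary r → IsBinary (node [l, r])

theorem size_lt_size_node₂ (l r : PlaneTree) :
    l.size < (node [l, r]).size ∧ r.size < (node [l, r]).size := by
  have hc : ∀ i : ℕ, Function.Injective (List.cons i) := fun i a b h => by simpa using h
  constructor
  · rw [size, ← Finset.card_image_of_injective l.vertices (hc 0)]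
    refine Finset.card_lt_card (Finset.ssubset_iff.2 ⟨[], by simp, ?_⟩)
    intro x hx
    simp only [vertices, forestVertices, Finset.mem_insert, Finset.mem_union] at hx ⊢
    tauto
  · rw [size, ← Finset.card_image_of_injective r.vertices (hc 1)]
    refine Finset.card_lt_card (Finset.ssubset_iff.2 ⟨[], by simp, ?_⟩)
    intro x hx
    simp only [vertices, forestVertices, Finset.mem_insert, Finset.mem_union] at hx ⊢
    tauto

theorem finite_binary_size_lt (n : ℕ) : {T : PlaneTree | IsBinary T ∧ T.size < n}.Finite := by
  induction n with
  | zero => simp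
  | succ n ih =>
    refine ((ih.image2 (fun l r => node [l, r]) ih).insert (node [])).subset ?_
    rintro T ⟨hT, hs⟩
    cases hT with
    | leaf => exact Or.inl rfl
    | node₂ l r hl hr =>
      have h := size_lt_size_node₂ l r
      exact Or.inr ⟨l, ⟨hl, by omega⟩, r, ⟨hr, by omega⟩, rfl⟩

theorem finite_binary (n : ℕ) : {T : PlaneTree | IsBinary T ∧ T.size = n}.Finite :=
  (finite_binary_size_lt (n + 1)).subset fun _ h => ⟨h.1, by have := h.2; omega⟩

/-- The family `B_n` of plane binary trees with `n` vertices. -/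
noncomputable def binaryFamily (n : ℕ) : Finset PlaneTree := (finite_binary n).toFinset

/-- `a_{B_n}(S)`: the number of all embeddings of `S` into all trees of the family `B_n`. -/
noncomputable def allCountBinary (n : ℕ) (S : PlaneTree) : ℕ :=
  ∑ T ∈ binaryFamily n, allCount T S

/-- `g_{B_n}(S)`: the number of good embeddings of `S` into all trees of the family `B_n`. -/
noncomputable def goodCountBinary (n : ℕ) (S : PlaneTree) : ℕ :=
  ∑ T ∈ binaryFamily n, goodCount T S

end PlaneTree

-- Plane embeddings described by the shape of a vertex set

namespace PlaneTree

-- The ratio `g/a` for `S` is governed by one integer, the weight `w(S)` = number of vertices plus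
-- number of leaves.
--
-- A set of vertices determines the plane forest it induces, so embeddings of `S` are the sets
-- inducing the one-tree forest `[S]` (`isEmbedding_iff_induced`). Cutting a binary tree at its root
-- then gives convolution recursions for generating functions indexed by the number of internal
-- vertices. With `y = √(1 - 4X)`, the Catalan equation says `1 - 2X·occGF [] = y`, and the
-- recursions become `y·occGF [node F] = goodGF F` and, for forests with at least two trees,
-- `y·occGF F = X·∑` over proper splits of `F`. By induction `X·goodGF F = c(1 - y)^p y^(-(w-2))`
-- and `X·occGF [S] = c(1 - y)^p y^(-(w-1))` for `S = node F`, with the same `c > 0` and `p`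
-- (`isPosMul_goodGF_of_forall`, `isPosMul_occGF`).
--
-- The factor `(1 - y)^p` tends to `1` at the singularity `X = 1/4`, and coefficient asymptotics
-- show that `g/a`, multiplied by `√(m+1)` for `2m+1` vertices, tends to `Γ((w-1)/2)/Γ((w-2)/2)`.
-- Log-convexity of `Γ` makes this limit strictly increasing in `w`. An embedding forces `w(S₁) <
-- w(S₂)` unless the trees are equal (`weight_lt_or_eq_of_subset`), so the strict inequality of
-- limits settles all large `n`, and equality of trees is trivial.

theorem leftOf_nil_left (q : List ℕ) : ¬ LeftOf [] q := by
  rintro ⟨c, p', q', i, j, hp, -, -⟩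
  simp at hp

theorem leftOf_nil_right (p : List ℕ) : ¬ LeftOf p [] := by
  rintro ⟨c, p', q', i, j, -, hq, -⟩
  simp at hq

theorem leftOf_cons_cons {i j : ℕ} {p q : List ℕ} :
    LeftOf (i :: p) (j :: q) ↔ i < j ∨ i = j ∧ LeftOf p q := by
  constructor
  · rintro ⟨c, p', q', a, b, hp, hq, hab⟩
    cases c with
    | nil =>
      simp only [List.nil_append, List.cons.injEq] at hp hq
      left
      omega
    | cons k c =>
      simp only [List.cons_append, List.cons.injEq] at hp hq
      exact Or.inr ⟨hp.1.trans hq.1.symm, c, p', q', a, b, hp.2, hq.2, hab⟩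
  · rintro (h | ⟨rfl, c, p', q', a, b, rfl, rfl, hab⟩)
    · exact ⟨[], p, q, i, j, rfl, rfl, h⟩
    · exact ⟨i :: c, p', q', a, b, rfl, rfl, hab⟩

theorem LeftOf.not_prefix {p q : List ℕ} (h : LeftOf p q) : ¬ p <+: q := by
  induction p generalizing q with
  | nil => exact absurd h (leftOf_nil_left q)
  | cons i p ih =>
    cases q with
    | nil => exact absurd h (leftOf_nil_right _)
    | cons j q =>
      rw [leftOf_cons_cons] at h
      rw [List.cons_prefix_cons]
      rintro ⟨rfl, hpq⟩
      rcases h with h | ⟨-, h⟩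
      · omega
      · exact ih h hpq

theorem LeftOf.not_prefix' {p q : List ℕ} (h : LeftOf p q) : ¬ q <+: p := by
  induction p generalizing q with
  | nil => exact absurd h (leftOf_nil_left q)
  | cons i p ih =>
    cases q with
    | nil => exact absurd h (leftOf_nil_right _)
    | cons j q =>
      rw [leftOf_cons_cons] at h
      rw [List.cons_prefix_cons]
      rintro ⟨rfl, hpq⟩
      rcases h with h | ⟨-, h⟩
      · omega
      · exact ih h hpq

theorem LeftOf.asymm {p q : List ℕ} (h : LeftOf p q) : ¬ LeftOf q p := by
  induction p generalizing q with
  | nil => exact absurd h (leftOf_nil_left q)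
  | cons i p ih =>
    cases q with
    | nil => exact absurd h (leftOf_nil_right _)
    | cons j q =>
      rw [leftOf_cons_cons] at h ⊢
      rintro (h' | ⟨rfl, h'⟩)
      · omega
      · rcases h with h | ⟨-, h⟩
        · omega
        · exact ih h h'

theorem LeftOf.mono {p q p' q' : List ℕ} (h : LeftOf p q) (hp : p <+: p') (hq : q <+: q') :
    LeftOf p' q' := by
  obtain ⟨c, a, b, i, j, rfl, rfl, hij⟩ := h
  obtain ⟨r, rfl⟩ := hp
  obtain ⟨s, rfl⟩ := hq
  exact ⟨c, a ++ r, b ++ s, i, j, by simp, by simp, hij⟩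

theorem prefix_antisymm {p q : List ℕ} (h : p <+: q) (h' : q <+: p) : p = q :=
  h.eq_of_length (le_antisymm h.length_le h'.length_le)

/-- `f` preserves the prefix order and the left-to-right order on `X`. -/
def PreservesPlane (f : List ℕ → List ℕ) (X : Set (List ℕ)) : Prop :=
  ∀ u ∈ X, ∀ v ∈ X, (u <+: v ↔ f u <+: f v) ∧ (LeftOf u v → LeftOf (f u) (f v))

theorem PreservesPlane.mono {f : List ℕ → List ℕ} {X Y : Set (List ℕ)}
    (h : PreservesPlane f Y) (hXY : X ⊆ Y) : PreservesPlane f X :=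
  fun u hu v hv => h u (hXY hu) v (hXY hv)

theorem PreservesPlane.injOn {f : List ℕ → List ℕ} {X : Set (List ℕ)}
    (h : PreservesPlane f X) : Set.InjOn f X := by
  intro u hu v hv huv
  refine prefix_antisymm ((h u hu v hv).1.2 ?_) ((h v hv u hu).1.2 ?_) <;> rw [huv]

theorem preservesPlane_cons (i : ℕ) (X : Set (List ℕ)) : PreservesPlane (List.cons i) X := by
  intro u _ v _
  simp [leftOf_cons_cons, List.cons_prefix_cons]

/-- The set of paths `X`, with the prefix order and the left-to-right order, is a copy of the
plane forest `F`. -/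
inductive Shape : Set (List ℕ) → List PlaneTree → Prop
  | nil : Shape ∅ []
  | cons {u : List ℕ} {X Y : Set (List ℕ)} {cs ts : List PlaneTree}
      (hX : ∀ x ∈ X, u <+: x ∧ x ≠ u) (hY : ∀ y ∈ Y, LeftOf u y)
      (hcs : Shape X cs) (hts : Shape Y ts) : Shape (insert u X ∪ Y) (node cs :: ts)

/-- The root `u` of the first tree is forced: every other element lies below it or to its right.
Then `X` and `Y` are forced too, as the elements strictly below `u` and those to its right. -/
theorem Shape.unique {X : Set (List ℕ)} {F G : List PlaneTree} (hF : Shape X F)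
    (hG : Shape X G) : F = G := by
  induction hF generalizing G with
  | nil =>
    generalize hZ : (∅ : Set (List ℕ)) = Z at hG
    cases hG with
    | nil => rfl
    | @cons u X Y cs ts =>
      have : u ∈ (∅ : Set (List ℕ)) := by
        rw [hZ]
        exact Or.inl (Or.inl rfl)
      exact this.elim
  | @cons u X Y cs ts hX hY hcs hts ih₁ ih₂ =>
    generalize hZ : insert u X ∪ Y = Z at hG
    cases hG with
    | nil =>
      have : u ∈ (∅ : Set (List ℕ)) := by
        rw [← hZ]
        exact Or.inl (Or.inl rfl)
      exact this.elim
    | @cons u' X' Y' cs' ts' hX' hY' hcs' hts' =>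
      have key : ∀ v, v ∈ insert u X ∪ Y ↔ v ∈ insert u' X' ∪ Y' := fun v => by rw [hZ]
      have hu : u = u' := by
        have h₁ := (key u).1 (Or.inl (Or.inl rfl))
        have h₂ := (key u').2 (Or.inl (Or.inl rfl))
        rcases h₁ with (h₁ | h₁) | h₁
        · exact h₁
        · have h₁ := (hX' _ h₁).1
          rcases h₂ with (h₂ | h₂) | h₂
          · exact h₂.symm
          · exact prefix_antisymm (hX _ h₂).1 h₁
          · exact absurd h₁ (hY _ h₂).not_prefix'
        · have h₁ := hY' _ h₁
          rcases h₂ with (h₂ | h₂) | h₂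
          · exact h₂.symm
          · exact absurd (hX _ h₂).1 h₁.not_prefix'
          · exact absurd (hY _ h₂) h₁.asymm
      subst hu
      have hXX : X = X' := by
        ext v
        constructor
        · intro hv
          rcases (key v).1 (Or.inl (Or.inr hv)) with (h | h) | h
          · exact absurd h (hX v hv).2
          · exact h
          · exact absurd (hX v hv).1 (hY' v h).not_prefix
        · intro hv
          rcases (key v).2 (Or.inl (Or.inr hv)) with (h | h) | h
          · exact absurd h (hX' v hv).2
          · exact h
          · exact absurd (hX' v hv).1 (hY v h).not_prefix
      have hYY : Y = Y' := by
        ext v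
        constructor
        · intro hv
          rcases (key v).1 (Or.inr hv) with (h | h) | h
          · exact absurd (h ▸ List.prefix_rfl) (hY v hv).not_prefix
          · exact absurd (hX' v h).1 (hY v hv).not_prefix
          · exact h
        · intro hv
          rcases (key v).2 (Or.inr hv) with (h | h) | h
          · exact absurd (h ▸ List.prefix_rfl) (hY' v hv).not_prefix
          · exact absurd (hX v h).1 (hY' v hv).not_prefix
          · exact h
      subst hXX hYY
      rw [ih₁ hcs', ih₂ hts']

theorem Shape.image {X : Set (List ℕ)} {F : List PlaneTree} (h : Shape X F)
    {f : List ℕ → List ℕ} (hf : PreservesPlane f X) : Shape (f '' X) F := by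
  induction h with
  | nil => simpa using Shape.nil
  | @cons u X Y cs ts hX hY _ _ ih₁ ih₂ =>
    have hu : u ∈ insert u X ∪ Y := Or.inl (Or.inl rfl)
    have hx : ∀ x ∈ X, x ∈ insert u X ∪ Y := fun x hx => Or.inl (Or.inr hx)
    have hy : ∀ y ∈ Y, y ∈ insert u X ∪ Y := fun y hy => Or.inr hy
    rw [Set.image_union, Set.image_insert_eq]
    refine Shape.cons ?_ ?_ (ih₁ (hf.mono hx)) (ih₂ (hf.mono hy))
    · rintro _ ⟨x, hxX, rfl⟩
      refine ⟨(hf u hu x (hx x hxX)).1.1 (hX x hxX).1, fun h => (hX x hxX).2 ?_⟩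
      exact hf.injOn (hx x hxX) hu h
    · rintro _ ⟨y, hyY, rfl⟩
      exact (hf u hu y (hy y hyY)).2 (hY y hyY)

theorem Shape.append {X Y : Set (List ℕ)} {F G : List PlaneTree} (hF : Shape X F)
    (hG : Shape Y G) (h : ∀ x ∈ X, ∀ y ∈ Y, LeftOf x y) : Shape (X ∪ Y) (F ++ G) := by
  induction hF with
  | nil => simpa using hG
  | @cons u X Z cs ts hX hZ hcs hts ih₁ ih₂ =>
    rw [Set.union_assoc]
    refine Shape.cons hX ?_ hcs (ih₂ fun z hz y hy => h z (Or.inr hz) y hy)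
    rintro y (hy | hy)
    · exact hZ y hy
    · exact h u (Or.inl (Or.inl rfl)) y hy

theorem exists_of_mem_forestVertices {i : ℕ} {ts : List PlaneTree} {p : List ℕ}
    (hp : p ∈ forestVertices i ts) : ∃ j q, p = j :: q ∧ i ≤ j := by
  induction ts generalizing i with
  | nil => simp [forestVertices] at hp
  | cons t ts ih =>
    simp only [forestVertices, Finset.mem_union, Finset.mem_image] at hp
    rcases hp with ⟨q, -, rfl⟩ | hp
    · exact ⟨i, q, rfl, le_rfl⟩
    · obtain ⟨j, q, rfl, hj⟩ := ih hp
      exact ⟨j, q, rfl, by omega⟩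

theorem nil_notMem_forestVertices (i : ℕ) (ts : List PlaneTree) : [] ∉ forestVertices i ts := by
  intro h
  obtain ⟨j, q, h, -⟩ := exists_of_mem_forestVertices h
  simp at h

theorem coe_forestVertices_cons (i : ℕ) (cs ts : List PlaneTree) :
    (forestVertices i (node cs :: ts) : Set (List ℕ)) =
      insert [i] (List.cons i '' (forestVertices 0 cs : Set (List ℕ))) ∪
        (forestVertices (i + 1) ts : Set (List ℕ)) := by
  rw [forestVertices, vertices]
  push_cast
  rw [Set.image_insert_eq]

theorem shape_forestVertices : ∀ (i : ℕ) (ts : List PlaneTree),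
    Shape (forestVertices i ts : Set (List ℕ)) ts
  | i, [] => by simpa [forestVertices] using Shape.nil
  | i, node cs :: ts => by
    have h₁ := (shape_forestVertices 0 cs).image (preservesPlane_cons i _)
    have h₂ := shape_forestVertices (i + 1) ts
    rw [coe_forestVertices_cons]
    refine Shape.cons ?_ ?_ h₁ h₂
    · rintro _ ⟨p, hp, rfl⟩
      refine ⟨by simp [List.cons_prefix_cons], fun h => ?_⟩
      obtain rfl : p = [] := by simpa using h
      exact nil_notMem_forestVertices _ _ hp
    · intro y hy
      obtain ⟨j, q, rfl, hj⟩ := exists_of_mem_forestVertices hy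
      exact leftOf_cons_cons.2 (Or.inl (by omega))

/-- Converse of transporting a shape along a map: an actual isomorphism from the standard copy of
`F` is recovered, by gluing the isomorphisms for the branches of the first tree and for the
remaining trees. -/
theorem Shape.exists_bijOn {X : Set (List ℕ)} {F : List PlaneTree} (h : Shape X F) (i : ℕ) :
    ∃ f, Set.BijOn f (forestVertices i F : Set (List ℕ)) X ∧
      PreservesPlane f (forestVertices i F : Set (List ℕ)) := by
  induction h generalizing i with
  | nil => exact ⟨id, by simp [forestVertices], by simp [forestVertices, PreservesPlane]⟩
  | @cons u X Y cs ts hX hY _ _ ih₁ ih₂ =>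
    obtain ⟨f, hf, hf'⟩ := ih₁ 0
    obtain ⟨g, hg, hg'⟩ := ih₂ (i + 1)
    let k : List ℕ → List ℕ := fun p =>
      if p = [i] then u else if p.head? = some i then f p.tail else g p
    have k₀ : k [i] = u := by simp [k]
    have k₁ : ∀ p ∈ forestVertices 0 cs, k (i :: p) = f p := by
      intro p hp
      have : p ≠ [] := fun h => nil_notMem_forestVertices _ _ (h ▸ hp)
      simp [k, this]
    have k₂ : ∀ p ∈ forestVertices (i + 1) ts, k p = g p := by
      intro p hp
      obtain ⟨j, q, rfl, hj⟩ := exists_of_mem_forestVertices hp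
      have : j ≠ i := by omega
      simp [k, this]
    have hXY : ∀ x ∈ X, ∀ y ∈ Y, LeftOf x y := fun x hx y hy =>
      (hY y hy).mono (hX x hx).1 List.prefix_rfl
    have lt : ∀ p, ∀ q ∈ forestVertices (i + 1) ts, LeftOf (i :: p) q := by
      intro p q hq
      obtain ⟨j, q, rfl, hj⟩ := exists_of_mem_forestVertices hq
      exact leftOf_cons_cons.2 (Or.inl (by omega))
    -- For pairs in different pieces only the horizontal order needs checking: it excludes
    -- comparability and the reverse horizontal order.
    have ltk : ∀ {p q}, LeftOf p q → LeftOf (k p) (k q) →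
        (p <+: q ↔ k p <+: k q) ∧ (LeftOf p q → LeftOf (k p) (k q)) := fun h h' =>
      ⟨⟨fun h₁ => absurd h₁ h.not_prefix, fun h₁ => absurd h₁ h'.not_prefix⟩, fun _ => h'⟩
    have gtk : ∀ {p q}, LeftOf q p → LeftOf (k q) (k p) →
        (p <+: q ↔ k p <+: k q) ∧ (LeftOf p q → LeftOf (k p) (k q)) := fun h h' =>
      ⟨⟨fun h₁ => absurd h₁ h.not_prefix', fun h₁ => absurd h₁ h'.not_prefix'⟩,
        fun h₁ => absurd h₁ h.asymm⟩
    have hk : PreservesPlane k (forestVertices i (node cs :: ts) : Set (List ℕ)) := by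
      rw [coe_forestVertices_cons]
      rintro p ((rfl | ⟨p, hp, rfl⟩) | hp) q ((rfl | ⟨q, hq, rfl⟩) | hq)
      · exact ⟨by simp, fun h => absurd List.prefix_rfl h.not_prefix⟩
      · rw [k₀, k₁ q hq]
        have h₁ : [i] <+: i :: q := by simp [List.cons_prefix_cons]
        have h₂ := (hX _ (hf.mapsTo hq)).1
        exact ⟨by simp [h₂, List.cons_prefix_cons], fun h => absurd h₁ h.not_prefix⟩
      · refine ltk (lt _ _ hq) ?_
        rw [k₀, k₂ q hq]
        exact hY _ (hg.mapsTo hq)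
      · rw [k₀, k₁ p hp]
        have h₁ : [i] <+: i :: p := by simp [List.cons_prefix_cons]
        have h₂ := hX _ (hf.mapsTo hp)
        have h₃ : p ≠ [] := fun h => nil_notMem_forestVertices _ _ (h ▸ hp)
        refine ⟨⟨fun h => absurd h (by simpa [List.cons_prefix_cons] using h₃), fun h => ?_⟩,
          fun h => absurd h₁ h.not_prefix'⟩
        exact absurd (prefix_antisymm h h₂.1) h₂.2
      · rw [k₁ p hp, k₁ q hq]
        simpa [List.cons_prefix_cons, leftOf_cons_cons] using hf' p hp q hq
      · refine ltk (lt _ _ hq) ?_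
        rw [k₁ p hp, k₂ q hq]
        exact hXY _ (hf.mapsTo hp) _ (hg.mapsTo hq)
      · refine gtk (lt _ _ hp) ?_
        rw [k₀, k₂ p hp]
        exact hY _ (hg.mapsTo hp)
      · refine gtk (lt _ _ hp) ?_
        rw [k₁ q hq, k₂ p hp]
        exact hXY _ (hf.mapsTo hq) _ (hg.mapsTo hp)
      · rw [k₂ p hp, k₂ q hq]
        exact hg' p hp q hq
    refine ⟨k, ⟨?_, hk.injOn, ?_⟩, hk⟩
    · rw [coe_forestVertices_cons]
      rintro p ((rfl | ⟨p, hp, rfl⟩) | hp)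
      · rw [k₀]
        exact Or.inl (Or.inl rfl)
      · rw [k₁ p hp]
        exact Or.inl (Or.inr (hf.mapsTo hp))
      · rw [k₂ p hp]
        exact Or.inr (hg.mapsTo hp)
    · rw [coe_forestVertices_cons]
      rintro x ((rfl | hx) | hx)
      · exact ⟨[i], Or.inl (Or.inl rfl), k₀⟩
      · obtain ⟨p, hp, rfl⟩ := hf.surjOn hx
        exact ⟨i :: p, Or.inl (Or.inr ⟨p, hp, rfl⟩), k₁ p hp⟩
      · obtain ⟨p, hp, rfl⟩ := hg.surjOn hx
        exact ⟨p, Or.inr hp, k₂ p hp⟩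

theorem mem_forestVertices_iff {i j : ℕ} {p : List ℕ} {ts : List PlaneTree} :
    j :: p ∈ forestVertices i ts ↔ i ≤ j ∧ ∃ t, ts[j - i]? = some t ∧ p ∈ t.vertices := by
  induction ts generalizing i with
  | nil => simp [forestVertices]
  | cons t ts ih =>
    simp only [forestVertices, Finset.mem_union, Finset.mem_image, ih, List.cons.injEq]
    constructor
    · rintro (⟨q, hq, rfl, rfl⟩ | ⟨h, s, hs, hp⟩)
      · exact ⟨le_rfl, t, by simp, hq⟩
      · refine ⟨by omega, s, ?_, hp⟩
        rw [show j - i = (j - (i + 1)) + 1 by omega]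
        simpa using hs
    · rintro ⟨h, s, hs, hp⟩
      rcases h.eq_or_lt with rfl | h
      · left
        simp only [Nat.sub_self, List.getElem?_cons_zero, Option.some.injEq] at hs
        exact ⟨p, hs ▸ hp, rfl, rfl⟩
      · right
        rw [show j - i = (j - (i + 1)) + 1 by omega] at hs
        exact ⟨by omega, s, by simpa using hs, hp⟩

theorem nil_mem_vertices (T : PlaneTree) : [] ∈ T.vertices := by
  cases T
  simp [vertices]

theorem mem_vertices_of_append {p q : List ℕ} {T : PlaneTree} (h : p ++ q ∈ T.vertices) :
    p ∈ T.vertices := by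
  induction p generalizing T with
  | nil => exact nil_mem_vertices T
  | cons i p ih =>
    obtain ⟨ts⟩ := T
    simp only [vertices, List.cons_append, Finset.mem_insert, reduceCtorEq, false_or,
      mem_forestVertices_iff] at h ⊢
    obtain ⟨hi, t, ht, hp⟩ := h
    exact ⟨hi, t, ht, ih hp⟩

theorem forestVertices_singleton (S : PlaneTree) :
    (forestVertices 0 [S] : Set (List ℕ)) = List.cons 0 '' (S.vertices : Set (List ℕ)) := by
  simp [forestVertices]

theorem shape_vertices (S : PlaneTree) : Shape (S.vertices : Set (List ℕ)) [S] := by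
  obtain ⟨cs⟩ := S
  rw [vertices, Finset.coe_insert, ← Set.union_empty (insert _ _)]
  refine Shape.cons ?_ (by simp) (shape_forestVertices 0 cs) Shape.nil
  intro x hx
  refine ⟨List.nil_prefix, ?_⟩
  rintro rfl
  exact nil_notMem_forestVertices _ _ hx

/-- Order among siblings suffices for the full horizontal order: two incomparable vertices lie
weakly below distinct siblings, and `LeftOf` is inherited by descendants. -/
theorem isEmbedding_iff_shape {S T : PlaneTree} {A : Finset (List ℕ)} :
    IsEmbedding S T A ↔ A ⊆ T.vertices ∧ Shape (A : Set (List ℕ)) [S] := by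
  refine and_congr_right fun _ => ?_
  constructor
  · rintro ⟨f, hf, hpre, hleft⟩
    have hP : PreservesPlane f (S.vertices : Set (List ℕ)) := by
      refine fun u hu v hv => ⟨hpre u hu v hv, ?_⟩
      rintro ⟨c, p, q, i, j, rfl, rfl, hij⟩
      have hp : c ++ [i] ∈ S.vertices := mem_vertices_of_append (q := p) (by simpa using hu)
      have hq : c ++ [j] ∈ S.vertices := mem_vertices_of_append (q := q) (by simpa using hv)
      refine (hleft c i j hp hq hij).mono ((hpre _ hp _ hu).1 ?_) ((hpre _ hq _ hv).1 ?_)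
      · exact ⟨p, by simp⟩
      · exact ⟨q, by simp⟩
    rw [← hf.image_eq]
    exact (shape_vertices S).image hP
  · intro h
    obtain ⟨f, hf, hP⟩ := h.exists_bijOn 0
    rw [forestVertices_singleton] at hf hP
    refine ⟨f ∘ List.cons 0, hf.comp ⟨Set.mapsTo_image _ _, ?_, Set.surjOn_image _ _⟩, ?_, ?_⟩
    · exact (preservesPlane_cons 0 _).injOn
    · intro u hu v hv
      have := (hP _ (Set.mem_image_of_mem _ hu) _ (Set.mem_image_of_mem _ hv)).1
      simpa [List.cons_prefix_cons] using this
    · intro u i j hi hj hij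
      refine (hP _ (Set.mem_image_of_mem _ hi) _ (Set.mem_image_of_mem _ hj)).2 ?_
      exact ⟨0 :: u, [], [], i, j, by simp, by simp, hij⟩

-- The forest induced by a vertex set

open Classical in
mutual
/-- The plane forest that the set of vertices `A` induces in a plane tree. -/
noncomputable def induced : PlaneTree → Set (List ℕ) → List PlaneTree
  | node ts, A => if [] ∈ A then [node (inducedForest 0 ts A)] else inducedForest 0 ts A
/-- The plane forest that the set of vertices `A` induces in a plane forest, the first tree of
which has position `i`. -/
noncomputable def inducedForest : ℕ → List PlaneTree → Set (List ℕ) → List PlaneTree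
  | _, [], _ => []
  | i, t :: ts, A => induced t (List.cons i ⁻¹' A) ++ inducedForest (i + 1) ts A
end

mutual
theorem shape_induced : ∀ (T : PlaneTree) (A : Set (List ℕ)),
    Shape (A ∩ (T.vertices : Set (List ℕ))) (induced T A)
  | node ts, A => by
    have h := shape_inducedForest 0 ts A
    rw [vertices, Finset.coe_insert, induced]
    split_ifs with hA
    · rw [Set.inter_insert_of_mem hA, ← Set.union_empty (insert _ _)]
      refine Shape.cons ?_ (by simp) h Shape.nil
      rintro x ⟨-, hx⟩
      refine ⟨List.nil_prefix, ?_⟩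
      rintro rfl
      exact nil_notMem_forestVertices _ _ hx
    · rwa [Set.inter_insert_of_notMem hA]
theorem shape_inducedForest : ∀ (i : ℕ) (ts : List PlaneTree) (A : Set (List ℕ)),
    Shape (A ∩ (forestVertices i ts : Set (List ℕ))) (inducedForest i ts A)
  | i, [], A => by simpa [forestVertices, inducedForest] using Shape.nil
  | i, t :: ts, A => by
    have h₁ := (shape_induced t (List.cons i ⁻¹' A)).image (preservesPlane_cons i _)
    have h₂ := shape_inducedForest (i + 1) ts A
    rw [Set.image_preimage_inter] at h₁
    rw [forestVertices, inducedForest, Finset.coe_union, Finset.coe_image, Set.inter_union_distrib_left]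
    refine h₁.append h₂ ?_
    rintro _ ⟨-, p, -, rfl⟩ y ⟨-, hy⟩
    obtain ⟨j, q, rfl, hj⟩ := exists_of_mem_forestVertices hy
    exact leftOf_cons_cons.2 (Or.inl (by omega))
end

theorem isEmbedding_iff_induced {S T : PlaneTree} {A : Finset (List ℕ)} :
    IsEmbedding S T A ↔ A ⊆ T.vertices ∧ induced T (A : Set (List ℕ)) = [S] := by
  rw [isEmbedding_iff_shape]
  refine and_congr_right fun hA => ?_
  have h := shape_induced T A
  rw [Set.inter_eq_left.2 (Finset.coe_subset.2 hA)] at h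
  exact ⟨fun hS => h.unique hS, fun hS => hS ▸ h⟩

end PlaneTree

-- Counting vertex sets that induce a given forest

namespace PlaneTree

theorem inducedForest_congr {i : ℕ} {ts : List PlaneTree} {A B : Set (List ℕ)}
    (h : ∀ j p, i ≤ j → (j :: p ∈ A ↔ j :: p ∈ B)) :
    inducedForest i ts A = inducedForest i ts B := by
  induction ts generalizing i with
  | nil => rfl
  | cons t ts ih =>
    rw [inducedForest, inducedForest, ih fun j p hj => h j p (by omega)]
    congr 2
    ext p
    exact h i p le_rfl

theorem inducedForest_insert_nil (ts : List PlaneTree) (A : Set (List ℕ)) :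
    inducedForest 0 ts (insert [] A) = inducedForest 0 ts A :=
  inducedForest_congr (by simp)

open Classical in
/-- The number of vertex sets of `T` that induce the forest `F`. -/
noncomputable def occ (T : PlaneTree) (F : List PlaneTree) : ℕ :=
  (T.vertices.powerset.filter fun A : Finset (List ℕ) => induced T (A : Set (List ℕ)) = F).card

open Classical in
/-- The number of sets of vertices of the forest `ts` that induce the forest `F`. -/
noncomputable def occForest (i : ℕ) (ts F : List PlaneTree) : ℕ :=
  ((forestVertices i ts).powerset.filter fun A : Finset (List ℕ) =>
    inducedForest i ts (A : Set (List ℕ)) = F).card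

theorem allCount_eq_occ (T S : PlaneTree) : allCount T S = occ T [S] := by
  classical
  rw [allCount, occ]
  congr 1
  ext A
  simp only [Finset.mem_filter, Finset.mem_powerset, isEmbedding_iff_induced]
  tauto

theorem nil_notMem_of_mem_powerset {i : ℕ} {ts : List PlaneTree} {A : Finset (List ℕ)}
    (h : A ∈ (forestVertices i ts).powerset) : [] ∉ A :=
  fun h' => nil_notMem_forestVertices i ts (Finset.mem_powerset.1 h h')

theorem insert_nil_injOn (i : ℕ) (ts : List PlaneTree) :
    Set.InjOn (insert [] : Finset (List ℕ) → Finset (List ℕ))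
      ((forestVertices i ts).powerset : Set (Finset (List ℕ))) := by
  intro A hA B hB h
  have := congrArg (fun C => Finset.erase C []) h
  simpa [Finset.erase_insert (nil_notMem_of_mem_powerset hA),
    Finset.erase_insert (nil_notMem_of_mem_powerset hB)] using this

-- Deleting the root is a bijection from good embeddings to the sets below the root that induce the
-- branches `F`.
open Classical in
theorem goodCount_eq_occForest (ts F : List PlaneTree) :
    goodCount (node ts) (node F) = occForest 0 ts F := by
  rw [goodCount, occForest, ← Finset.card_image_of_injOn
    ((insert_nil_injOn 0 ts).mono (Finset.coe_subset.2 (Finset.filter_subset _ _)))]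
  congr 1
  ext A
  simp only [Finset.mem_filter, Finset.mem_powerset, Finset.mem_image, isEmbedding_iff_induced]
  constructor
  · rintro ⟨hA, ⟨-, h⟩, hn⟩
    refine ⟨A.erase [], ⟨?_, ?_⟩, Finset.insert_erase hn⟩
    · rwa [vertices, Finset.subset_insert_iff] at hA
    · rw [induced, if_pos (by simpa using hn)] at h
      rw [← inducedForest_insert_nil, ← Finset.coe_insert, Finset.insert_erase hn]
      simpa using h
  · rintro ⟨B, ⟨hB, h⟩, rfl⟩
    have : insert [] B ⊆ (node ts).vertices := by
      rw [vertices]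
      exact Finset.insert_subset_insert _ hB
    refine ⟨this, ⟨this, ?_⟩, by simp⟩
    rw [induced, if_pos (by simp), Finset.coe_insert, inducedForest_insert_nil, h]

open Classical in
theorem occ_node (ts F : List PlaneTree) :
    occ (node ts) F = occForest 0 ts F +
      ((forestVertices 0 ts).powerset.filter fun A : Finset (List ℕ) =>
        [node (inducedForest 0 ts (A : Set (List ℕ)))] = F).card := by
  rw [occ, vertices, Finset.powerset_insert, Finset.filter_union, Finset.card_union_of_disjoint,
    Finset.filter_image, Finset.card_image_of_injOn
    ((insert_nil_injOn 0 ts).mono (Finset.coe_subset.2 (Finset.filter_subset _ _))), occForest]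
  · congr 2
    · refine Finset.filter_congr fun A hA => ?_
      rw [induced, if_neg (by simpa using nil_notMem_of_mem_powerset hA)]
    · refine Finset.filter_congr fun A hA => ?_
      rw [induced, if_pos (by simp), Finset.coe_insert, inducedForest_insert_nil]
  · rw [Finset.disjoint_left]
    intro A hA hA'
    simp only [Finset.mem_filter, Finset.mem_image] at hA hA'
    obtain ⟨⟨B, -, rfl⟩, -⟩ := hA'
    exact nil_notMem_of_mem_powerset hA.1 (by simp)

/-- The two terms count the sets that miss the root and those that contain it; in the latter case
the rest must induce `F`. -/
theorem occ_node_singleton (ts F : List PlaneTree) :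
    occ (node ts) [node F] = occForest 0 ts [node F] + occForest 0 ts F := by
  classical
  rw [occ_node, occForest, occForest]
  congr 2
  refine Finset.filter_congr fun A _ => ?_
  simp

theorem occ_node_of_length_ne_one (ts F : List PlaneTree) (hF : F.length ≠ 1) :
    occ (node ts) F = occForest 0 ts F := by
  classical
  rw [occ_node, Finset.filter_false_of_mem]
  · simp
  · rintro A - rfl
    simp at hF

theorem occForest_nil (i : ℕ) (F : List PlaneTree) :
    occForest i [] F = if F = [] then 1 else 0 := by
  classical
  rw [occForest]
  simp [forestVertices, inducedForest, Finset.filter_singleton, eq_comm, apply_ite Finset.card]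

open Classical in
theorem occForest_cons_eq_card (i : ℕ) (t : PlaneTree) (ts F : List PlaneTree) :
    occForest i (t :: ts) F =
      ((t.vertices.powerset ×ˢ (forestVertices (i + 1) ts).powerset).filter
        fun P : Finset (List ℕ) × Finset (List ℕ) =>
        induced t (P.1 : Set (List ℕ)) ++ inducedForest (i + 1) ts (P.2 : Set (List ℕ)) = F).card := by
  have hnot : ∀ {B : Finset (List ℕ)} {p : List ℕ}, B ⊆ forestVertices (i + 1) ts →
      i :: p ∉ B := by
    intro B p hB h
    obtain ⟨j, q, h, hj⟩ := exists_of_mem_forestVertices (hB h)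
    simp only [List.cons.injEq] at h
    omega
  have hind : ∀ A B : Finset (List ℕ), B ⊆ forestVertices (i + 1) ts →
      inducedForest i (t :: ts) ((A.image (List.cons i) ∪ B : Finset (List ℕ)) : Set (List ℕ)) =
      induced t (A : Set (List ℕ)) ++ inducedForest (i + 1) ts (B : Set (List ℕ)) := by
    intro A B hB
    rw [inducedForest]
    congr 1
    · congr 1
      ext p
      simp [hnot hB]
    · refine inducedForest_congr fun j p hj => ?_
      have : i ≠ j := by omega
      simp [this]
  rw [occForest]
  symm
  refine Finset.card_bij (fun P _ => P.1.image (List.cons i) ∪ P.2) ?_ ?_ ?_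
  · rintro ⟨A, B⟩ h
    simp only [Finset.mem_filter, Finset.mem_product, Finset.mem_powerset, forestVertices] at h ⊢
    refine ⟨Finset.union_subset_union (Finset.image_subset_image h.1.1) h.1.2, ?_⟩
    rw [hind A B h.1.2, h.2]
  · rintro ⟨A, B⟩ h ⟨A', B'⟩ h' heq
    simp only [Finset.mem_filter, Finset.mem_product, Finset.mem_powerset] at h h' heq
    have key := Finset.ext_iff.1 heq
    have hA : A = A' := by
      ext p
      simpa [hnot h.1.2, hnot h'.1.2] using key (i :: p)
    have hB : B = B' := by
      ext p
      by_cases hp : p ∈ forestVertices (i + 1) ts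
      · obtain ⟨j, q, rfl, hj⟩ := exists_of_mem_forestVertices hp
        have : i ≠ j := by omega
        simpa [this] using key (j :: q)
      · exact ⟨fun h₁ => absurd (h.1.2 h₁) hp, fun h₁ => absurd (h'.1.2 h₁) hp⟩
    rw [hA, hB]
  · intro C hC
    simp only [Finset.mem_filter, Finset.mem_powerset, forestVertices] at hC
    obtain ⟨hC, hF⟩ := hC
    have hCC : (t.vertices.filter fun p => i :: p ∈ C).image (List.cons i) ∪
        C.filter (· ∈ forestVertices (i + 1) ts) = C := by
      ext p
      simp only [Finset.mem_union, Finset.mem_image, Finset.mem_filter]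
      constructor
      · rintro (⟨q, hq, rfl⟩ | hp)
        · exact hq.2
        · exact hp.1
      · intro hp
        rcases Finset.mem_union.1 (hC hp) with h | h
        · obtain ⟨q, hq, rfl⟩ := Finset.mem_image.1 h
          exact Or.inl ⟨q, ⟨hq, hp⟩, rfl⟩
        · exact Or.inr ⟨hp, h⟩
    have hsub : C.filter (· ∈ forestVertices (i + 1) ts) ⊆ forestVertices (i + 1) ts := by
      intro p hp
      exact (Finset.mem_filter.1 hp).2
    refine ⟨(t.vertices.filter fun p => i :: p ∈ C,
      C.filter (· ∈ forestVertices (i + 1) ts)), ?_, hCC⟩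
    simp only [Finset.mem_filter, Finset.mem_product, Finset.mem_powerset]
    refine ⟨⟨Finset.filter_subset _ _, hsub⟩, ?_⟩
    rw [← hind _ _ hsub, hCC, hF]

/-- Sort the sets by the number `k` of trees of `F` induced inside `t`; for fixed `k` the choices in
`t` and in `ts` are independent. -/
theorem occForest_cons (i : ℕ) (t : PlaneTree) (ts F : List PlaneTree) :
    occForest i (t :: ts) F = ∑ k ∈ Finset.range (F.length + 1),
      occ t (F.take k) * occForest (i + 1) ts (F.drop k) := by
  classical
  rw [occForest_cons_eq_card, Finset.card_eq_sum_card_fiberwise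
    (f := fun P : Finset (List ℕ) × Finset (List ℕ) => (induced t (P.1 : Set (List ℕ))).length)
    (t := Finset.range (F.length + 1))]
  · refine Finset.sum_congr rfl fun k hk => ?_
    rw [occ, occForest, ← Finset.card_product, ← Finset.filter_product, Finset.filter_filter]
    congr 1
    refine Finset.filter_congr ?_
    rintro ⟨A, B⟩ -
    constructor
    · rintro ⟨rfl, rfl⟩
      simp
    · rintro ⟨h₁, h₂⟩
      simp only at h₁ h₂
      rw [Finset.mem_range] at hk
      simp only [h₁, h₂, List.take_append_drop, List.length_take, true_and]
      omega
  · rintro ⟨A, B⟩ h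
    have h := (Finset.mem_filter.1 h).2
    simp [← h]

theorem occForest_singleton (i : ℕ) (t : PlaneTree) (F : List PlaneTree) :
    occForest i [t] F = occ t F := by
  rw [occForest_cons, Finset.sum_range_succ, Finset.sum_eq_zero]
  · simp [occForest_nil]
  · intro k hk
    have : ¬ F.length ≤ k := by simpa using hk
    simp [occForest_nil, this]

theorem occForest_pair (l r : PlaneTree) (F : List PlaneTree) :
    occForest 0 [l, r] F = ∑ k ∈ Finset.range (F.length + 1),
      occ l (F.take k) * occ r (F.drop k) := by
  simp only [occForest_cons 0 l, occForest_singleton]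

-- The weight and its monotonicity under embeddings

mutual
/-- The number of vertices plus the number of leaves of a plane tree. -/
def weight : PlaneTree → ℕ
  | node ts => if ts = [] then 2 else 1 + forestWeight ts
/-- The number of vertices plus the number of leaves of a plane forest. -/
def forestWeight : List PlaneTree → ℕ
  | [] => 0
  | t :: ts => weight t + forestWeight ts
end

theorem two_le_weight : ∀ T : PlaneTree, 2 ≤ T.weight
  | node [] => by simp [weight]
  | node (t :: ts) => by
    have := two_le_weight t
    simp only [weight, forestWeight, reduceCtorEq, if_false]
    omega

theorem forestWeight_append (F G : List PlaneTree) :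
    forestWeight (F ++ G) = forestWeight F + forestWeight G := by
  induction F with
  | nil => simp [forestWeight]
  | cons t ts ih => simp only [List.cons_append, forestWeight, ih]; omega

theorem forestWeight_pos {F : List PlaneTree} (hF : F ≠ []) : 2 ≤ forestWeight F := by
  cases F with
  | nil => exact absurd rfl hF
  | cons t ts =>
    have := two_le_weight t
    simp only [forestWeight]
    omega

mutual
-- Dropping a vertex loses at least one unit of weight: a new leaf can appear only when all vertices
-- below it disappear, and these have weight at least `2`, against the one unit gained.
theorem weight_induced : ∀ (T : PlaneTree) (A : Set (List ℕ)),
    forestWeight (induced T A) ≤ weight T ∧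
      (forestWeight (induced T A) = weight T → induced T A = [T])
  | node ts, A => by
    have h := weight_inducedForest 0 ts A
    rw [induced]
    by_cases hts : ts = []
    · subst hts
      split_ifs <;> simp [inducedForest, forestWeight, weight]
    · have hw := forestWeight_pos hts
      split_ifs with hA
      · by_cases hi : inducedForest 0 ts A = []
        · simp only [hi, forestWeight, weight, hts, if_true, if_false]
          omega
        · simp only [forestWeight, weight, hts, hi, if_false]
          refine ⟨by omega, fun h' => ?_⟩
          rw [h.2 (by omega)]
      · simp only [weight, hts, if_false]
        exact ⟨by omega, fun h' => by omega⟩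
theorem weight_inducedForest : ∀ (i : ℕ) (ts : List PlaneTree) (A : Set (List ℕ)),
    forestWeight (inducedForest i ts A) ≤ forestWeight ts ∧
      (forestWeight (inducedForest i ts A) = forestWeight ts → inducedForest i ts A = ts)
  | _, [], _ => by simp [inducedForest]
  | i, t :: ts, A => by
    have h₁ := weight_induced t (List.cons i ⁻¹' A)
    have h₂ := weight_inducedForest (i + 1) ts A
    rw [inducedForest, forestWeight_append, forestWeight]
    refine ⟨by omega, fun h => ?_⟩
    rw [h₁.2 (by omega), h₂.2 (by omega)]
    rfl
end

theorem weight_lt_or_eq_of_subset {S T : PlaneTree} (h : S ⊆ T) : S.weight < T.weight ∨ S = T := by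
  obtain ⟨A, hA⟩ := h
  have hA := (isEmbedding_iff_induced.1 hA).2
  have h := weight_induced T (A : Set (List ℕ))
  rw [hA] at h
  simp only [forestWeight, add_zero, List.cons.injEq, and_true] at h
  rcases h.1.lt_or_eq with h' | h'
  · exact Or.inl h'
  · exact Or.inr (h.2 h')

end PlaneTree

-- Gamma function and coefficient asymptotics

open Filter Topology PowerSeries

/-- Euler's limit for `Γ`, inverted and corrected by `n / (n + a) → 1`. At a pole `a = -m` the
product vanishes for `n > m`, and the convention `Γ(-m) = 0` with `0⁻¹ = 0` gives the correct value
of `1/Γ`. -/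
theorem Real.tendsto_ascPochhammer_mul_rpow (a : ℝ) :
    Tendsto (fun n : ℕ => (∏ j ∈ Finset.range n, (a + j)) / (n.factorial : ℝ) * (n : ℝ) ^ (1 - a))
      atTop (𝓝 (Real.Gamma a)⁻¹) := by
  by_cases ha : ∃ m : ℕ, a = -m
  · obtain ⟨m, rfl⟩ := ha
    rw [Real.Gamma_neg_nat_eq_zero, inv_zero]
    refine tendsto_const_nhds.congr' ?_
    filter_upwards [eventually_gt_atTop m] with n hn
    rw [Finset.prod_eq_zero (Finset.mem_range.2 hn) (by ring)]
    simp
  · have ha : ∀ m : ℕ, a ≠ -m := fun m h => ha ⟨m, h⟩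
    have h₁ := (Real.GammaSeq_tendsto_Gamma a).inv₀ (Real.Gamma_ne_zero ha)
    have h₂ : Tendsto (fun n : ℕ => (n : ℝ) / (n + a)) atTop (𝓝 1) :=
      tendsto_natCast_div_add_atTop a
    have h₃ := h₁.mul h₂
    rw [mul_one] at h₃
    refine h₃.congr' ?_
    filter_upwards [eventually_gt_atTop 0] with n hn
    have hn' : (0 : ℝ) < n := by exact_mod_cast hn
    have hne : (n : ℝ) + a ≠ 0 := fun h => ha n (by linarith)
    have hpow : (n : ℝ) ^ a ≠ 0 := (Real.rpow_pos_of_pos hn' a).ne'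
    have hf : (n.factorial : ℝ) ≠ 0 := by exact_mod_cast n.factorial_ne_zero
    rw [Real.GammaSeq, Finset.prod_range_succ, Real.rpow_sub hn', Real.rpow_one, add_comm a n]
    rw [inv_div]
    field_simp

theorem Real.Gamma_add_half_sq_le {a : ℝ} (ha : 0 < a) :
    Real.Gamma (a + 1 / 2) ^ 2 ≤ Real.Gamma a * Real.Gamma (a + 1) := by
  have h := Real.Gamma_mul_add_mul_le_rpow_Gamma_mul_rpow_Gamma (s := a) (t := a + 1)
    (a := 1 / 2) (b := 1 / 2) ha (by linarith) (by norm_num) (by norm_num) (by norm_num)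
  have h₁ := Real.Gamma_pos_of_pos ha
  have h₂ := Real.Gamma_pos_of_pos (show 0 < a + 1 by linarith)
  have h₃ := Real.Gamma_pos_of_pos (show 0 < a + 1 / 2 by linarith)
  rw [show 1 / 2 * a + 1 / 2 * (a + 1) = a + 1 / 2 by ring, ← Real.mul_rpow h₁.le h₂.le,
    ← Real.sqrt_eq_rpow] at h
  calc _ ≤ (√(Real.Gamma a * Real.Gamma (a + 1))) ^ 2 := by gcongr
    _ = _ := Real.sq_sqrt (by positivity)

/-- Strictness comes from using the weak inequality at `a + 1`: the functional equation brings it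
back to `a` with the extra factor `a(a + 1)/(a + 1/2)² < 1`. -/
theorem Real.Gamma_add_half_sq_lt {a : ℝ} (ha : 0 < a) :
    Real.Gamma (a + 1 / 2) ^ 2 < Real.Gamma a * Real.Gamma (a + 1) := by
  have h := Real.Gamma_add_half_sq_le (show 0 < a + 1 by linarith)
  rw [show a + 1 + 1 / 2 = (a + 1 / 2) + 1 by ring, Real.Gamma_add_one (s := a + 1 / 2) (by linarith),
    Real.Gamma_add_one (s := a + 1) (by linarith)] at h
  have h₂ := Real.Gamma_pos_of_pos (show 0 < a + 1 by linarith)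
  have h₃ := Real.Gamma_pos_of_pos (show 0 < a + 1 / 2 by linarith)
  have h₄ := Real.Gamma_add_one ha.ne'
  have h₅ := Real.Gamma_pos_of_pos ha
  rw [h₄] at h ⊢
  by_contra! h'
  have : (a + 1 / 2) ^ 2 * (Real.Gamma a * (a * Real.Gamma a)) ≤
      (a * (a + 1)) * (Real.Gamma a * (a * Real.Gamma a)) := by
    calc _ ≤ (a + 1 / 2) ^ 2 * Real.Gamma (a + 1 / 2) ^ 2 := by gcongr
      _ = ((a + 1 / 2) * Real.Gamma (a + 1 / 2)) ^ 2 := by ring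
      _ ≤ _ := h
      _ = _ := by ring
  have := le_of_mul_le_mul_right this (by positivity)
  nlinarith

/-- The quotient of `Γ((q + 1) / 2)` by `Γ(q / 2)`, which is `0` at `q = 0`. -/
noncomputable def gammaQuotient (q : ℕ) : ℝ :=
  Real.Gamma (((q : ℝ) + 1) / 2) / Real.Gamma ((q : ℝ) / 2)

/-- For `q > 0` this is the strict log-convexity inequality at `a = q / 2`. At `q = 0` division by
`Γ(0) = 0` gives `0`, below the positive next value. -/
theorem gammaQuotient_strictMono : StrictMono gammaQuotient := by
  refine strictMono_nat_of_lt_succ fun q => ?_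
  have h₁ : 0 < Real.Gamma (((q : ℝ) + 1) / 2) := Real.Gamma_pos_of_pos (by positivity)
  have h₂ : 0 < Real.Gamma (((q : ℝ) + 2) / 2) := Real.Gamma_pos_of_pos (by positivity)
  have e : ((q + 1 : ℕ) : ℝ) + 1 = q + 2 := by push_cast; ring
  rw [gammaQuotient, gammaQuotient, e, Nat.cast_succ]
  rcases q.eq_zero_or_pos with rfl | hq
  · simp only [Nat.cast_zero, zero_div, Real.Gamma_zero, div_zero]
    simp only [Nat.cast_zero] at h₁ h₂
    positivity
  · have hq' : (0 : ℝ) < q := by exact_mod_cast hq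
    have h₀ : 0 < Real.Gamma ((q : ℝ) / 2) := Real.Gamma_pos_of_pos (by positivity)
    have h := Real.Gamma_add_half_sq_lt (show 0 < (q : ℝ) / 2 by positivity)
    rw [div_lt_div_iff₀ h₀ h₁]
    rw [show (q : ℝ) / 2 + 1 / 2 = (q + 1) / 2 by ring, show (q : ℝ) / 2 + 1 = (q + 2) / 2 by ring] at h
    linarith

/-- The power series `(1 - 4 X) ^ (- r / 2)`. -/
noncomputable def invSqrtPow (r : ℤ) : ℝ⟦X⟧ :=
  rescale (-4) (binomialSeries ℝ (-(r : ℝ) / 2))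

theorem invSqrtPow_add (q r : ℤ) : invSqrtPow (q + r) = invSqrtPow q * invSqrtPow r := by
  rw [invSqrtPow, invSqrtPow, invSqrtPow, ← map_mul, ← binomialSeries_add]
  congr 2
  push_cast
  ring

theorem invSqrtPow_zero : invSqrtPow 0 = 1 := by
  simp [invSqrtPow]

theorem invSqrtPow_neg_two : invSqrtPow (-2) = 1 - 4 * X := by
  have h := binomialSeries_nat (R := ℝ) (A := ℝ) 1
  rw [invSqrtPow]
  norm_num at h ⊢
  rw [h, map_add, map_one, rescale_X]
  simp [sub_eq_add_neg, show C (4 : ℝ) = 4 from map_ofNat C 4]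

theorem constantCoeff_invSqrtPow (r : ℤ) : constantCoeff (invSqrtPow r) = 1 := by
  rw [← coeff_zero_eq_constantCoeff_apply, invSqrtPow, coeff_rescale]
  simp

theorem coeff_invSqrtPow (r : ℤ) (n : ℕ) : coeff n (invSqrtPow r) =
    4 ^ n * ((∏ j ∈ Finset.range n, ((r : ℝ) / 2 + j)) / (n.factorial : ℝ)) := by
  rw [invSqrtPow, coeff_rescale, binomialSeries_coeff, Ring.choose_eq_smul]
  have : ∀ n, (descPochhammer ℤ n).smeval (-(r : ℝ) / 2) =
      (-1) ^ n * ∏ j ∈ Finset.range n, ((r : ℝ) / 2 + j) := by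
    intro n
    induction n with
    | zero => simp [descPochhammer]
    | succ n ih =>
      rw [descPochhammer_succ_right, Polynomial.smeval_mul, ih, Finset.prod_range_succ]
      simp [Polynomial.smeval_sub, Polynomial.smeval_natCast]
      ring
  rw [this, smul_eq_mul, smul_eq_mul, mul_one, neg_pow]
  have h : ((-1 : ℝ) ^ n) * (-1) ^ n = 1 := by rw [← mul_pow]; simp
  generalize ∏ j ∈ Finset.range n, ((r : ℝ) / 2 + j) = P
  linear_combination (4 : ℝ) ^ n * (n.factorial : ℝ)⁻¹ * P * h

/-- The power `p` does not affect the leading term: in each factor `1 - y` the part `-y` lowers `r`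
by one, hence the coefficients by the order `n^(-1/2)`. -/
theorem tendsto_coeff_one_sub_pow_mul (p : ℕ) (r : ℤ) :
    Tendsto (fun n : ℕ => coeff n ((1 - invSqrtPow (-1)) ^ p * invSqrtPow r) / 4 ^ n *
      (n : ℝ) ^ (1 - (r : ℝ) / 2)) atTop (𝓝 (Real.Gamma ((r : ℝ) / 2))⁻¹) := by
  induction p generalizing r with
  | zero =>
    refine (Real.tendsto_ascPochhammer_mul_rpow ((r : ℝ) / 2)).congr fun n => ?_
    rw [pow_zero, one_mul, coeff_invSqrtPow, mul_div_cancel_left₀ _ (by positivity)]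
  | succ p ih =>
    have h₁ := ih r
    have h₂ := ih (-1 + r)
    have h₃ : Tendsto (fun n : ℕ => (n : ℝ) ^ (-(1 / 2 : ℝ))) atTop (𝓝 0) :=
      (tendsto_rpow_neg_atTop (by norm_num)).comp tendsto_natCast_atTop_atTop
    have h₄ := h₁.sub (h₂.mul h₃)
    rw [mul_zero, sub_zero] at h₄
    refine h₄.congr' ?_
    filter_upwards [eventually_gt_atTop 0] with n hn
    have hn' : (0 : ℝ) < n := by exact_mod_cast hn
    rw [mul_assoc (_ / _), ← Real.rpow_add hn', pow_succ, mul_assoc (_ ^ p), sub_mul, one_mul,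
      mul_sub, map_sub, invSqrtPow_add]
    push_cast
    rw [show 1 - (-1 + (r : ℝ)) / 2 + -(1 / 2) = 1 - r / 2 by ring]
    ring

theorem tendsto_coeff_ratio (p q : ℕ) :
    Tendsto (fun n : ℕ => coeff n ((1 - invSqrtPow (-1)) ^ p * invSqrtPow q) /
      coeff n ((1 - invSqrtPow (-1)) ^ p * invSqrtPow (q + 1)) * (n : ℝ) ^ (1 / 2 : ℝ)) atTop
      (𝓝 (gammaQuotient q)) := by
  have h₁ := tendsto_coeff_one_sub_pow_mul p q
  have h₂ := tendsto_coeff_one_sub_pow_mul p (q + 1)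
  push_cast at h₁ h₂
  have h₀ : Real.Gamma (((q : ℝ) + 1) / 2) ≠ 0 := (Real.Gamma_pos_of_pos (by positivity)).ne'
  have h := h₁.div h₂ (inv_ne_zero h₀)
  rw [inv_div_inv] at h
  refine h.congr' ?_
  filter_upwards [eventually_gt_atTop 0] with n hn
  have hn' : (0 : ℝ) < n := by exact_mod_cast hn
  have e : (n : ℝ) ^ (1 - (q : ℝ) / 2) =
      (n : ℝ) ^ (1 - ((q : ℝ) + 1) / 2) * (n : ℝ) ^ (1 / 2 : ℝ) := by
    rw [← Real.rpow_add hn']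
    congr 1
    ring
  have hpos : (n : ℝ) ^ (1 - ((q : ℝ) + 1) / 2) ≠ 0 := (Real.rpow_pos_of_pos hn' _).ne'
  simp only [Pi.div_apply]
  rw [e]
  field_simp

theorem eventually_coeff_pos (p q : ℕ) :
    ∀ᶠ n : ℕ in atTop, 0 < coeff n ((1 - invSqrtPow (-1)) ^ p * invSqrtPow (q + 1)) := by
  have h := tendsto_coeff_one_sub_pow_mul p (q + 1)
  have h₀ : 0 < (Real.Gamma (((q + 1 : ℤ) : ℝ) / 2))⁻¹ := by
    refine inv_pos.2 (Real.Gamma_pos_of_pos ?_)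
    push_cast
    positivity
  filter_upwards [h.eventually (lt_mem_nhds h₀), eventually_gt_atTop 0] with n hn hn₀
  have hn' : (0 : ℝ) < n := by exact_mod_cast hn₀
  have := pos_of_mul_pos_left hn (Real.rpow_pos_of_pos hn' _).le
  exact (div_pos_iff_of_pos_right (by positivity)).1 this

-- Generating functions over plane binary trees

namespace PlaneTree

open Filter Topology PowerSeries

theorem size_leaf : (node []).size = 1 := by
  simp [size, vertices, forestVertices]

theorem size_node₂ (l r : PlaneTree) : (node [l, r]).size = l.size + r.size + 1 := by
  have hc : ∀ i : ℕ, Function.Injective (List.cons i) := fun _ => List.cons_injective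
  rw [size, vertices, Finset.card_insert_of_notMem (nil_notMem_forestVertices _ _)]
  simp only [forestVertices, Finset.union_empty]
  rw [Finset.card_union_of_disjoint, Finset.card_image_of_injective _ (hc _),
    Finset.card_image_of_injective _ (hc _), size, size]
  rw [Finset.disjoint_left]
  intro p hp hp'
  obtain ⟨q, -, rfl⟩ := Finset.mem_image.1 hp
  obtain ⟨q', -, h⟩ := Finset.mem_image.1 hp'
  simp at h

theorem mem_binaryFamily {n : ℕ} {T : PlaneTree} :
    T ∈ binaryFamily n ↔ IsBinary T ∧ T.size = n := by
  simp [binaryFamily]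

theorem IsBinary.exists_size_eq {T : PlaneTree} (h : IsBinary T) : ∃ m, T.size = 2 * m + 1 := by
  induction h with
  | leaf => exact ⟨0, size_leaf⟩
  | node₂ l r _ _ ihl ihr =>
    obtain ⟨a, ha⟩ := ihl
    obtain ⟨b, hb⟩ := ihr
    exact ⟨a + b + 1, by rw [size_node₂]; omega⟩

theorem binaryFamily_one : binaryFamily 1 = {node []} := by
  ext T
  rw [mem_binaryFamily, Finset.mem_singleton]
  constructor
  · rintro ⟨h, hs⟩
    cases h with
    | leaf => rfl
    | node₂ l r hl hr =>
      obtain ⟨a, ha⟩ := hl.exists_size_eq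
      rw [size_node₂] at hs
      omega
  · rintro rfl
    exact ⟨IsBinary.leaf, size_leaf⟩

theorem sum_binaryFamily_succ (φ : PlaneTree → ℝ) (m : ℕ) :
    ∑ T ∈ binaryFamily (2 * (m + 1) + 1), φ T = ∑ x ∈ Finset.HasAntidiagonal.antidiagonal m,
      ∑ l ∈ binaryFamily (2 * x.1 + 1), ∑ r ∈ binaryFamily (2 * x.2 + 1), φ (node [l, r]) := by
  simp_rw [← Finset.sum_product' (f := fun l r => φ (node [l, r]))]
  rw [Finset.sum_sigma']
  symm
  refine Finset.sum_bij (fun y _ => node [y.2.1, y.2.2]) ?_ ?_ ?_ ?_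
  · rintro ⟨⟨a, b⟩, l, r⟩ h
    simp only [Finset.mem_sigma, Finset.HasAntidiagonal.mem_antidiagonal, Finset.mem_product,
      mem_binaryFamily] at h ⊢
    obtain ⟨hab, ⟨hl, hl'⟩, hr, hr'⟩ := h
    exact ⟨IsBinary.node₂ l r hl hr, by rw [size_node₂]; omega⟩
  · rintro ⟨⟨a, b⟩, l, r⟩ h ⟨⟨a', b'⟩, l', r'⟩ h' heq
    simp only [Finset.mem_sigma, Finset.HasAntidiagonal.mem_antidiagonal, Finset.mem_product,
      mem_binaryFamily, node.injEq, List.cons.injEq, and_true] at h h' heq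
    obtain ⟨rfl, rfl⟩ := heq
    obtain rfl : a = a' := by omega
    obtain rfl : b = b' := by omega
    rfl
  · intro T hT
    rw [mem_binaryFamily] at hT
    obtain ⟨hT, hs⟩ := hT
    cases hT with
    | leaf =>
      rw [size_leaf] at hs
      omega
    | node₂ l r hl hr =>
      obtain ⟨a, ha⟩ := hl.exists_size_eq
      obtain ⟨b, hb⟩ := hr.exists_size_eq
      rw [size_node₂] at hs
      refine ⟨⟨(a, b), l, r⟩, ?_, rfl⟩
      simp only [Finset.mem_sigma, Finset.HasAntidiagonal.mem_antidiagonal, Finset.mem_product, mem_binaryFamily]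
      exact ⟨by omega, ⟨hl, ha⟩, hr, hb⟩
  · intro y _
    rfl

/-- The generating function of a statistic on plane binary trees by the number of internal
vertices. -/
noncomputable def binaryGF (φ : PlaneTree → ℝ) : ℝ⟦X⟧ :=
  PowerSeries.mk fun m => ∑ T ∈ binaryFamily (2 * m + 1), φ T

theorem binaryGF_add (φ ψ : PlaneTree → ℝ) :
    binaryGF (fun T => φ T + ψ T) = binaryGF φ + binaryGF ψ := by
  ext m
  simp [binaryGF, Finset.sum_add_distrib]

/-- Cutting at the root turns a statistic that splits over the two branches into Cauchy products;
`X` records the root as an internal vertex. -/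
theorem binaryGF_eq {ι : Type*} (s : Finset ι) (φ : PlaneTree → ℝ) (α β : ι → PlaneTree → ℝ)
    (h : ∀ l r, φ (node [l, r]) = ∑ k ∈ s, α k l * β k r) :
    binaryGF φ = C (φ (node [])) + X * ∑ k ∈ s, binaryGF (α k) * binaryGF (β k) := by
  ext m
  cases m with
  | zero => simp [binaryGF, binaryFamily_one]
  | succ m =>
    rw [map_add, coeff_succ_X_mul, map_sum, binaryGF, coeff_mk, sum_binaryFamily_succ]
    simp only [coeff_C, Nat.add_eq_zero_iff, one_ne_zero, and_false, if_false, zero_add, coeff_mul,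
      binaryGF, coeff_mk, h]
    rw [Finset.sum_comm]
    refine Finset.sum_congr rfl fun x _ => ?_
    simp_rw [Finset.sum_mul_sum]
    symm
    rw [Finset.sum_comm]
    refine Finset.sum_congr rfl fun l _ => ?_
    rw [Finset.sum_comm]

/-- The generating function of the number of embeddings of a forest into plane binary trees. -/
noncomputable def occGF (F : List PlaneTree) : ℝ⟦X⟧ := binaryGF fun T => occ T F

/-- The generating function of the number of good embeddings of the tree with the root branches `F`
into plane binary trees. -/
noncomputable def goodGF (F : List PlaneTree) : ℝ⟦X⟧ := binaryGF fun T => goodCount T (node F)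

theorem occGF_singleton (F : List PlaneTree) :
    occGF [node F] = goodGF [node F] + goodGF F := by
  rw [occGF, goodGF, goodGF, ← binaryGF_add]
  congr 1
  ext ⟨ts⟩
  rw [occ_node_singleton, goodCount_eq_occForest, goodCount_eq_occForest]
  push_cast
  rfl

theorem occGF_eq_goodGF (F : List PlaneTree) (hF : F.length ≠ 1) : occGF F = goodGF F := by
  rw [occGF, goodGF]
  congr 1
  ext ⟨ts⟩
  rw [occ_node_of_length_ne_one ts F hF, goodCount_eq_occForest]

theorem goodGF_eq (F : List PlaneTree) : goodGF F = C (if F = [] then 1 else 0) +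
    X * ∑ k ∈ Finset.range (F.length + 1), occGF (F.take k) * occGF (F.drop k) := by
  rw [goodGF, binaryGF_eq (Finset.range (F.length + 1)) _
    (fun k T => (occ T (F.take k) : ℝ)) (fun k T => (occ T (F.drop k) : ℝ))]
  · rw [goodCount_eq_occForest, occForest_nil]
    push_cast
    rfl
  · intro l r
    rw [goodCount_eq_occForest, occForest_pair]
    push_cast
    rfl

theorem occGF_nil : occGF [] = 1 + X * (occGF [] * occGF []) := by
  conv_lhs => rw [occGF_eq_goodGF [] (by simp), goodGF_eq]
  simp

/-- Completing the square in the Catalan equation shows that both sides square to `1 - 4X`; the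
constant term fixes the sign. -/
theorem one_sub_two_mul_X_mul_occGF_nil : 1 - 2 * (X * occGF []) = invSqrtPow (-1) := by
  have h : (1 - 2 * (X * occGF [])) * (1 - 2 * (X * occGF [])) =
      invSqrtPow (-1) * invSqrtPow (-1) := by
    rw [← invSqrtPow_add, show (-1 + -1 : ℤ) = -2 by norm_num, invSqrtPow_neg_two]
    linear_combination (-4 * X) * occGF_nil
  rcases mul_self_eq_mul_self_iff.1 h with h | h
  · exact h
  · have := congrArg constantCoeff h
    rw [map_neg, constantCoeff_invSqrtPow] at this
    simp at this
    norm_num at this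

/-- The two extreme splits, all of `F` on one side, together contribute `2X·occGF []·occGF F`, which
is `(1 - y)·occGF F`. -/
theorem goodGF_eq_of_ne_nil (F : List PlaneTree) (hF : F ≠ []) :
    goodGF F = (1 - invSqrtPow (-1)) * occGF F +
      X * ∑ k ∈ Finset.range (F.length - 1), occGF (F.take (k + 1)) * occGF (F.drop (k + 1)) := by
  have hlen : F.length + 1 = (F.length - 1) + 1 + 1 := by
    have := List.length_pos_iff.2 hF
    omega
  have hlen' : F.length - 1 + 1 = F.length := by omega
  rw [goodGF_eq, if_neg hF, hlen, Finset.sum_range_succ, Finset.sum_range_succ', hlen',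
    ← one_sub_two_mul_X_mul_occGF_nil]
  simp only [map_zero, List.take_zero, List.drop_zero, List.take_length, List.drop_length]
  ring

/-- A one-tree forest has no proper split, so the sets missing the root contribute exactly `(1 -
y)·occGF [node F]`. This is the link between good and all embeddings. -/
theorem invSqrtPow_mul_occGF_singleton (F : List PlaneTree) :
    invSqrtPow (-1) * occGF [node F] = goodGF F := by
  have h₁ := occGF_singleton F
  have h₂ := goodGF_eq_of_ne_nil [node F] (by simp)
  simp only [List.length_singleton, Nat.sub_self, Finset.range_zero, Finset.sum_empty, mul_zero,
    add_zero] at h₂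
  linear_combination h₁ + h₂

theorem invSqrtPow_mul_occGF (F : List PlaneTree) (hF : 2 ≤ F.length) :
    invSqrtPow (-1) * occGF F =
      X * ∑ k ∈ Finset.range (F.length - 1), occGF (F.take (k + 1)) * occGF (F.drop (k + 1)) := by
  have h₁ := occGF_eq_goodGF F (by omega)
  have h₂ := goodGF_eq_of_ne_nil F (by rintro rfl; simp at hF)
  linear_combination h₁ + h₂

mutual
/-- The number of vertices with at most one child. -/
def thinCount : PlaneTree → ℕ
  | node ts => forestThinCount ts + if ts.length ≤ 1 then 1 else 0
/-- The number of vertices with at most one child in a forest. -/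
def forestThinCount : List PlaneTree → ℕ
  | [] => 0
  | t :: ts => thinCount t + forestThinCount ts
end

theorem forestThinCount_append (F G : List PlaneTree) :
    forestThinCount (F ++ G) = forestThinCount F + forestThinCount G := by
  induction F with
  | nil => simp [forestThinCount]
  | cons t ts ih => simp only [List.cons_append, forestThinCount, ih]; omega

/-- `f` is a positive multiple of `(1 - √(1 - 4X)) ^ p * (1 - 4X) ^ (- r / 2)`. -/
def IsPosMul (f : ℝ⟦X⟧) (p : ℕ) (r : ℤ) : Prop :=
  ∃ c : ℝ, 0 < c ∧ f = C c * ((1 - invSqrtPow (-1)) ^ p * invSqrtPow r)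

theorem IsPosMul.mul {f g : ℝ⟦X⟧} {p p' : ℕ} {r r' : ℤ} (hf : IsPosMul f p r)
    (hg : IsPosMul g p' r') : IsPosMul (f * g) (p + p') (r + r') := by
  obtain ⟨c, hc, rfl⟩ := hf
  obtain ⟨d, hd, rfl⟩ := hg
  refine ⟨c * d, mul_pos hc hd, ?_⟩
  rw [map_mul, invSqrtPow_add, pow_add]
  ring

theorem isPosMul_sum {ι : Type*} {s : Finset ι} (hs : s.Nonempty) {f : ι → ℝ⟦X⟧} {p : ℕ} {r : ℤ}
    (h : ∀ i ∈ s, IsPosMul (f i) p r) : IsPosMul (∑ i ∈ s, f i) p r := by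
  choose! c hc hf using h
  refine ⟨∑ i ∈ s, c i, Finset.sum_pos hc hs, ?_⟩
  rw [map_sum, Finset.sum_mul]
  exact Finset.sum_congr rfl hf

theorem isPosMul_invSqrtPow (r : ℤ) : IsPosMul (invSqrtPow r) 0 r :=
  ⟨1, one_pos, by simp⟩

theorem isPosMul_one_sub : IsPosMul (1 - invSqrtPow (-1)) 1 0 :=
  ⟨1, one_pos, by simp [invSqrtPow_zero]⟩

theorem invSqrtPow_one_mul_neg_one : invSqrtPow 1 * invSqrtPow (-1) = 1 := by
  rw [← invSqrtPow_add]
  simp [invSqrtPow_zero]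

/-- A root with at most one branch adds a factor `1 - y`, which is why `thinCount` is the exponent.
The bound on `occGF F` is a hypothesis so that this step can serve inside the induction on forests.
-/
theorem isPosMul_goodGF_of_forall {F : List PlaneTree}
    (h : F ≠ [] → IsPosMul (X * occGF F) (forestThinCount F) (forestWeight F - 1)) :
    IsPosMul (X * goodGF F) (node F).thinCount ((node F).weight - 2) := by
  by_cases hF : F = []
  · subst hF
    refine ⟨1 / 2, by norm_num, ?_⟩
    have h₁ := one_sub_two_mul_X_mul_occGF_nil
    have h₂ : C (1 / 2 : ℝ) * 2 = 1 := by
      rw [← map_ofNat C 2, ← map_mul]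
      norm_num
    rw [← occGF_eq_goodGF [] (by simp)]
    simp only [thinCount, forestThinCount, weight, List.length_nil, zero_le, if_true, zero_add,
      pow_one, Nat.cast_ofNat, sub_self, invSqrtPow_zero, mul_one, ← h₁, sub_sub_cancel]
    linear_combination (-(X * occGF [])) * h₂
  · have h := h hF
    have hw : (((node F).weight : ℕ) : ℤ) - 2 = forestWeight F - 1 := by
      simp only [weight, hF, if_false]
      push_cast
      ring
    rw [hw, thinCount]
    by_cases hl : F.length = 1
    · rw [if_pos hl.le, goodGF_eq_of_ne_nil F hF, hl]
      have := isPosMul_one_sub.mul h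
      simp only [Nat.sub_self, Finset.range_zero, Finset.sum_empty, mul_zero, add_zero]
      rw [add_comm 1, zero_add] at this
      convert this using 1
      ring
    · have : ¬ F.length ≤ 1 := by
        have := List.length_pos_iff.2 hF
        omega
      rw [if_neg this, add_zero, ← occGF_eq_goodGF F hl]
      exact h

theorem isPosMul_occGF (F : List PlaneTree) (hF : F ≠ []) :
    IsPosMul (X * occGF F) (forestThinCount F) (forestWeight F - 1) := by
  -- Weight drops both when a proper split is made and when the root of a single nonleaf tree is
  -- removed.
  induction hn : forestWeight F using Nat.strong_induction_on generalizing F with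
  | _ n ih =>
  subst hn
  by_cases hl : F.length = 1
  · obtain ⟨⟨G⟩, rfl⟩ := List.length_eq_one_iff.1 hl
    have hG := (isPosMul_invSqrtPow 1).mul
      (isPosMul_goodGF_of_forall (F := G) fun hG => ih _ (by simp [forestWeight, weight, hG]) G hG rfl)
    rw [← invSqrtPow_mul_occGF_singleton, zero_add] at hG
    simp only [forestThinCount, forestWeight, add_zero]
    convert hG using 1
    · linear_combination (-(X * occGF [node G])) * invSqrtPow_one_mul_neg_one
    · ring
  · have hl' : 2 ≤ F.length := by
      have := List.length_pos_iff.2 hF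
      omega
    -- All splits give the same exponents because weight and thin count are additive, so the
    -- positive multiples add up without cancellation.
    have hsum : IsPosMul (∑ k ∈ Finset.range (F.length - 1),
        (X * occGF (F.take (k + 1))) * (X * occGF (F.drop (k + 1))))
        (forestThinCount F) (forestWeight F - 2) := by
      refine isPosMul_sum (Finset.nonempty_range_iff.2 (by omega)) fun k hk => ?_
      have hk := Finset.mem_range.1 hk
      have h₁ : F.take (k + 1) ≠ [] := by
        intro h
        have := congrArg List.length h
        simp at this
        exact hF this
      have h₂ : F.drop (k + 1) ≠ [] := by
        intro h
        have := congrArg List.length h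
        simp at this
        omega
      have hw := forestWeight_append (F.take (k + 1)) (F.drop (k + 1))
      have hp := forestThinCount_append (F.take (k + 1)) (F.drop (k + 1))
      rw [List.take_append_drop] at hw hp
      have hw₁ := forestWeight_pos h₁
      have hw₂ := forestWeight_pos h₂
      have := (ih _ (by omega) _ h₁ rfl).mul (ih _ (by omega) _ h₂ rfl)
      rw [← hp] at this
      convert this using 1
      rw [hw]
      push_cast
      ring
    have := (isPosMul_invSqrtPow 1).mul hsum
    rw [zero_add] at this
    convert this using 1
    · have h₁ := invSqrtPow_mul_occGF F hl'
      have h₂ : ∑ k ∈ Finset.range (F.length - 1),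
          (X * occGF (F.take (k + 1))) * (X * occGF (F.drop (k + 1))) =
          X * (X * ∑ k ∈ Finset.range (F.length - 1),
            occGF (F.take (k + 1)) * occGF (F.drop (k + 1))) := by
        rw [Finset.mul_sum, Finset.mul_sum]
        refine Finset.sum_congr rfl fun k _ => ?_
        ring
      rw [h₂, ← h₁]
      linear_combination (-(X * occGF F)) * invSqrtPow_one_mul_neg_one
    · ring

/-- The constants `c` and `p` are shared, so they disappear from the leading term of the quotient.
The index `m + 1` comes from the factor `X`, and the truncated subtraction is exact since weights
are at least `2`. -/
theorem exists_coeff_formula (S : PlaneTree) : ∃ c : ℝ, 0 < c ∧ ∃ p : ℕ, ∀ m : ℕ,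
    (goodCountBinary (2 * m + 1) S : ℝ) = c * coeff (m + 1)
      ((1 - invSqrtPow (-1)) ^ p * invSqrtPow ((S.weight - 2 : ℕ) : ℤ)) ∧
    (allCountBinary (2 * m + 1) S : ℝ) = c * coeff (m + 1)
      ((1 - invSqrtPow (-1)) ^ p * invSqrtPow (((S.weight - 2 : ℕ) : ℤ) + 1)) := by
  obtain ⟨F⟩ := S
  obtain ⟨c, hc, h⟩ := isPosMul_goodGF_of_forall (isPosMul_occGF F)
  have hw := two_le_weight (node F)
  have e : (((node F).weight - 2 : ℕ) : ℤ) = ((node F).weight : ℤ) - 2 := by omega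
  rw [← e] at h
  refine ⟨c, hc, (node F).thinCount, fun m => ⟨?_, ?_⟩⟩
  · rw [← coeff_C_mul, ← h, coeff_succ_X_mul, goodGF, binaryGF, coeff_mk, goodCountBinary]
    push_cast
    rfl
  · have h' : C c * ((1 - invSqrtPow (-1)) ^ (node F).thinCount *
        invSqrtPow ((((node F).weight - 2 : ℕ) : ℤ) + 1)) = X * occGF [node F] := by
      rw [invSqrtPow_add]
      rw [← invSqrtPow_mul_occGF_singleton] at h
      linear_combination (-invSqrtPow 1) * h + (X * occGF [node F]) * invSqrtPow_one_mul_neg_one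
    rw [← coeff_C_mul, h', coeff_succ_X_mul, occGF, binaryGF, coeff_mk, allCountBinary]
    push_cast
    simp only [allCount_eq_occ]

theorem eventually_allCountBinary_pos (S : PlaneTree) :
    ∀ᶠ m : ℕ in atTop, 0 < allCountBinary (2 * m + 1) S := by
  obtain ⟨c, hc, p, h⟩ := exists_coeff_formula S
  filter_upwards [(tendsto_add_atTop_nat 1).eventually (eventually_coeff_pos p (S.weight - 2))]
    with m hm
  have := mul_pos hc hm
  rw [← (h m).2] at this
  exact_mod_cast this

theorem tendsto_good_div_all (S : PlaneTree) :
    Tendsto (fun m : ℕ => (goodCountBinary (2 * m + 1) S : ℝ) / allCountBinary (2 * m + 1) S *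
      ((m + 1 : ℕ) : ℝ) ^ (1 / 2 : ℝ)) atTop (𝓝 (gammaQuotient (S.weight - 2))) := by
  obtain ⟨c, hc, p, h⟩ := exists_coeff_formula S
  refine ((tendsto_coeff_ratio p (S.weight - 2)).comp (tendsto_add_atTop_nat 1)).congr fun m => ?_
  rw [(h m).1, (h m).2, mul_div_mul_left _ _ hc.ne']
  rfl

end PlaneTree

-- Comparison of the two ratios

open Filter in
theorem mainTheorem2 (S₁ S₂ : PlaneTree) (h : S₁ ⊆ S₂) :
    ∃ N : ℕ, ∀ n : ℕ, N ≤ n → Odd n →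
      0 < PlaneTree.allCountBinary n S₁ ∧ 0 < PlaneTree.allCountBinary n S₂ ∧
      (PlaneTree.goodCountBinary n S₁ : ℝ) / (PlaneTree.allCountBinary n S₁ : ℝ) ≤
        (PlaneTree.goodCountBinary n S₂ : ℝ) / (PlaneTree.allCountBinary n S₂ : ℝ) := by
  have key : ∀ᶠ m : ℕ in atTop, (PlaneTree.goodCountBinary (2 * m + 1) S₁ : ℝ) /
      (PlaneTree.allCountBinary (2 * m + 1) S₁ : ℝ) ≤
        (PlaneTree.goodCountBinary (2 * m + 1) S₂ : ℝ) /
        (PlaneTree.allCountBinary (2 * m + 1) S₂ : ℝ) := by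
    rcases PlaneTree.weight_lt_or_eq_of_subset h with hw | rfl
    · have h₁ := PlaneTree.two_le_weight S₁
      have hlt : gammaQuotient (S₁.weight - 2) < gammaQuotient (S₂.weight - 2) :=
        gammaQuotient_strictMono (by omega)
      -- Both ratios carry the same normalising factor `(m + 1)^(1/2)`, which cancels from the
      -- eventual inequality.
      filter_upwards [(PlaneTree.tendsto_good_div_all S₁).eventually_lt
        (PlaneTree.tendsto_good_div_all S₂) hlt] with m hm
      exact (lt_of_mul_lt_mul_right hm (by positivity)).le
    · exact Eventually.of_forall fun _ => le_rfl
  obtain ⟨M, hM⟩ := eventually_atTop.1 ((PlaneTree.eventually_allCountBinary_pos S₁).and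
    ((PlaneTree.eventually_allCountBinary_pos S₂).and key))
  refine ⟨2 * M + 1, ?_⟩
  rintro n hn ⟨m, rfl⟩
  exact hM m (by omega)
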